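/- **Notation.** For families $\mathcal A,\mathcal B$ of sets of subsets of a space, $S_1(\mathcal A,\mathcal B)$ says: for all $\mathcal U_1,\mathcal U_2,\dots\in\mathcal A$ there are $U_n\in\mathcal U_n$ with $\{U_n : n\in\mathbb N\}\in\mathcal B$; and $S_{\mathrm{fin}}(\mathcal A,\mathcal B)$ says: for all $\mathcal U_1,\mathcal U_2,\dots\in\mathcal A$ there are finite $\mathcal F_n\subseteq\mathcal U_n$ with $\bigcup_n\mathcal F_n\in\mathcal B$. For a topological space $Y$, let $D$ be the set of all families $\mathcal U\subseteq P(Y)$ with $\bigcup\mathcal U$ dense in $Y$; let $D_o$ be the set of those $\mathcal U\in D$ all of whose members are open; let $Op$ be the set of open covers of $Y$; and let $\Omega$ be the set of those $\mathcal U\in Op$ such that $Y\notin\mathcal U$ and every finite subset of $Y$ is contained in some member of $\mathcal U$. The Pixley–Roy space $\mathrm{PR}(Y)$ is the set of nonempty finite subsets of $Y$, with the topology whose basic open sets are $[F,U]=\{H\in\mathrm{PR}(Y): F\subseteq H\subseteq U\}$, for $F\in\mathrm{PR}(Y)$ and $U\subseteq Y$ open. For $X\subseteq\{0,1\}^{\mathbb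 N}$, the Cantor tree space is $\mathrm{CT}(X)=\{0,1\}^{<\infty}\cup\{\infty\}$, where $\{0,1\}^{<\infty}$ is the set of finite $0$-$1$ sequences, all its points are isolated, and the sets $$\mathrm{CT}(X)\setminus\bigl(\{0,1\}^{\le k}\cup\{s\in\{0,1\}^{<\infty}:\exists f\in F,\ f\text{ extends }s\}\bigr),$$ for $k\in\mathbb N$ and finite $F\subseteq X$, form a local base at $\infty$. **Theorem.** Let $X\subseteq\{0,1\}^{\mathbb N}$, with the subspace topology. The space $Y=\mathrm{PR}(\mathrm{CT}(X))$ is countable, and: 1. If $X$ satisfies $S_{\mathrm{fin}}(\Omega,\Omega)$ but not $S_1(\Omega,\Omega)$, then $Y$ satisfies $S_{\mathrm{fin}}(D,D)$, $S_{\mathrm{fin}}(D_o,D)$, $S_{\mathrm{fin}}(Op,D)$, $S_{\mathrm{fin}}(Op,Op)$, $S_1(Op,D)$ and $S_1(Op,Op)$, but neither $S_1(D,D)$ nor $S_1(D_o,D)$. The hypothesis holds for $X=\{0,1\}^{\mathbb N}$. 2. If $X$ does not satisfy $S_{\mathrm{fin}}(\Omega,\Omega)$, then $Y$ satisfies $S_{\mathrm{fin}}(Op,D)$,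 $S_{\mathrm{fin}}(Op,Op)$, $S_1(Op,D)$ and $S_1(Op,Op)$, but none of $S_{\mathrm{fin}}(D,D)$, $S_{\mathrm{fin}}(D_o,D)$, $S_1(D,D)$ and $S_1(D_o,D)$. The hypothesis holds for every $X\subseteq\{0,1\}^{\mathbb N}$ homeomorphic to the Baire space $\mathbb N^{\mathbb N}$, and such $X$ exist. -/

import Mathlib

/-! ### Selection principles and dense families -/

/-- `S₁(𝒜, ℬ)`: from each sequence of members of `𝒜` one can choose one element of each
member so that the chosen elements form a member of `ℬ`. -/
def SelOne {X : Type*} (A B : Set (Set (Set X))) : Prop :=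
  ∀ U : ℕ → Set (Set X), (∀ n, U n ∈ A) →
    ∃ V : ℕ → Set X, (∀ n, V n ∈ U n) ∧ Set.range V ∈ B

/-- `S_fin(𝒜, ℬ)`: from each sequence of members of `𝒜` one can choose finite subsets
whose union is a member of `ℬ`. -/
def SelFin {X : Type*} (A B : Set (Set (Set X))) : Prop :=
  ∀ U : ℕ → Set (Set X), (∀ n, U n ∈ A) →
    ∃ F : ℕ → Set (Set X), (∀ n, F n ⊆ U n ∧ (F n).Finite) ∧ (⋃ n, F n) ∈ B

/-- `D`: the dense families, i.e. the families of (arbitrary) subsets with dense union. -/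
def DenseFamilies (X : Type*) [TopologicalSpace X] : Set (Set (Set X)) :=
  {U | Dense (⋃₀ U)}

/-- `D_o`: the dense families of open sets. -/
def DenseOpenFamilies (X : Type*) [TopologicalSpace X] : Set (Set (Set X)) :=
  {U | Dense (⋃₀ U) ∧ ∀ V ∈ U, IsOpen V}

/-- `Op`: the open covers. -/
def OpenCovers (X : Type*) [TopologicalSpace X] : Set (Set (Set X)) :=
  {U | ⋃₀ U = Set.univ ∧ ∀ V ∈ U, IsOpen V}

/-- `Ω`: the open covers `U` such that each finite subset of `X` is contained in a member of `U`,
and `X` itself is not a member of `U`. -/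
def OmegaCovers (X : Type*) [TopologicalSpace X] : Set (Set (Set X)) :=
  {U | U ∈ OpenCovers X ∧ (∀ F : Set X, F.Finite → ∃ V ∈ U, F ⊆ V) ∧ Set.univ ∉ U}

/-! ### Pixley–Roy spaces -/

/-- The underlying set of the Pixley–Roy space: the nonempty finite subsets of `X`. -/
def PixleyRoy (X : Type*) : Type _ := {F : Finset X // F.Nonempty}

/-- The basic set `[F, U] = {H | F ⊆ H ⊆ U}`. -/
def PixleyRoy.basic {X : Type*} (F : PixleyRoy X) (U : Set X) : Set (PixleyRoy X) :=
  {H | (F.1 : Set X) ⊆ (H.1 : Set X) ∧ (H.1 : Set X) ⊆ U}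

/-- The Pixley–Roy topology. -/
instance PixleyRoy.instTopologicalSpace (X : Type*) [TopologicalSpace X] :
    TopologicalSpace (PixleyRoy X) :=
  TopologicalSpace.generateFrom
    {B | ∃ (F : PixleyRoy X) (U : Set X), IsOpen U ∧ B = PixleyRoy.basic F U}

/-! ### Cantor tree spaces -/

/-- The infinite binary sequence `f` extends the finite binary sequence `s`. -/
def ExtendsSeq (s : List Bool) (f : ℕ → Bool) : Prop :=
  ∀ (i : ℕ) (hi : i < s.length), s[i] = f i

/-- The underlying set of the Cantor tree space `CT(X)`: the finite binary sequences, together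
with one further point `∞`. -/
inductive CantorTree (X : Set (ℕ → Bool)) : Type
  | node (s : List Bool) : CantorTree X
  | infty : CantorTree X

/-- The basic neighbourhood of `∞` given by `k` and `F`: remove from `CT(X)` the sequences of
length at most `k`, and the sequences that are extended by a member of `F`. -/
def CantorTree.basicNhd (X : Set (ℕ → Bool)) (k : ℕ) (F : Set (ℕ → Bool)) :
    Set (CantorTree X) :=
  {p | ∀ s : List Bool, p = CantorTree.node s → ¬ (s.length ≤ k ∨ ∃ f ∈ F, ExtendsSeq s f)}

/-- The topology of `CT(X)`: finite sequences are isolated, and the sets `basicNhd X k F`, with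
`F ⊆ X` finite, form a local base at `∞`. -/
instance CantorTree.instTopologicalSpace (X : Set (ℕ → Bool)) :
    TopologicalSpace (CantorTree X) where
  IsOpen U := CantorTree.infty ∈ U →
    ∃ (k : ℕ) (F : Set (ℕ → Bool)), F.Finite ∧ F ⊆ X ∧ CantorTree.basicNhd X k F ⊆ U
  isOpen_univ := fun _ => ⟨0, ∅, Set.finite_empty, Set.empty_subset _, Set.subset_univ _⟩
  isOpen_inter := by
    rintro U V hU hV ⟨h1, h2⟩
    obtain ⟨k, F, hF, hFX, hk⟩ := hU h1
    obtain ⟨l, G, hG, hGX, hl⟩ := hV h2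
    refine ⟨max k l, F ∪ G, hF.union hG, Set.union_subset hFX hGX, fun p hp => ⟨hk ?_, hl ?_⟩⟩
    · rintro s hs (h | ⟨f, hf, hsf⟩)
      · exact hp s hs (Or.inl (h.trans (le_max_left _ _)))
      · exact hp s hs (Or.inr ⟨f, Or.inl hf, hsf⟩)
    · rintro s hs (h | ⟨f, hf, hsf⟩)
      · exact hp s hs (Or.inl (h.trans (le_max_right _ _)))
      · exact hp s hs (Or.inr ⟨f, Or.inr hf, hsf⟩)
  isOpen_sUnion := by
    rintro S hS ⟨U, hUS, hU⟩
    obtain ⟨k, F, hF, hFX, hk⟩ := hS U hUS hU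
    exact ⟨k, F, hF, hFX, hk.trans (Set.subset_sUnion_of_mem hUS)⟩

/-! ### The two settings -/

/-- All eight properties of the diagram hold, except for `S₁(D, D)` and `S₁(D_o, D)`. -/
def SettingTwo (Y : Type*) [TopologicalSpace Y] : Prop :=
  (SelFin (DenseFamilies Y) (DenseFamilies Y) ∧
    SelFin (DenseOpenFamilies Y) (DenseFamilies Y) ∧
    SelFin (OpenCovers Y) (DenseFamilies Y) ∧
    SelFin (OpenCovers Y) (OpenCovers Y)) ∧
  (¬ SelOne (DenseFamilies Y) (DenseFamilies Y) ∧
    ¬ SelOne (DenseOpenFamilies Y) (DenseFamilies Y) ∧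
    SelOne (OpenCovers Y) (DenseFamilies Y) ∧
    SelOne (OpenCovers Y) (OpenCovers Y))

/-- The four properties with first entry `D` or `D_o` fail, and the four properties with first
entry `Op` hold. -/
def SettingThree (Y : Type*) [TopologicalSpace Y] : Prop :=
  (¬ SelFin (DenseFamilies Y) (DenseFamilies Y) ∧
    ¬ SelFin (DenseOpenFamilies Y) (DenseFamilies Y) ∧
    SelFin (OpenCovers Y) (DenseFamilies Y) ∧
    SelFin (OpenCovers Y) (OpenCovers Y)) ∧
  (¬ SelOne (DenseFamilies Y) (DenseFamilies Y) ∧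
    ¬ SelOne (DenseOpenFamilies Y) (DenseFamilies Y) ∧
    SelOne (OpenCovers Y) (DenseFamilies Y) ∧
    SelOne (OpenCovers Y) (OpenCovers Y))

/-! ### Relations between the selection principles -/

/-! Everything rests on a dictionary between dense families in `PixleyRoy (CantorTree X)` and
ω-covers of `X`. A neighbourhood of `H ∋ ∞` is given by `k` and a finite `G ⊆ X`: it contains those
`K ⊇ H` whose new nodes are longer than `k` and extended by no point of `G`. The last condition says
`G ⊆ avoidSet H K`, an open set, so for fixed `H` and `k` a dense family yields sets that capture
every finite `G`. Since there are only countably many pairs `(H, k)`, `S_fin(Ω, Ω)` gives `S_fin(D,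
D)`.

Conversely, `traceSet` turns open subsets of `X` into open subsets of the Pixley–Roy space, ω-covers
into dense families, and density, tested at `{∞}`, back into the ω-property. Thus failures for `X`
pass to `S₁(D_o, D)` and `S_fin(D_o, D)`.

The principles starting from `Op` hold because the space is countable. The examples use compactness
of finite powers and Lebesgue measure (Cantor space), and a diagonal argument (Baire space). -/

theorem SelOne.selFin {X : Type*} {A B : Set (Set (Set X))} (h : SelOne A B) : SelFin A B := by
  intro U hU
  obtain ⟨V, hV, hB⟩ := h U hU
  refine ⟨fun n => {V n}, fun n => ⟨by simpa using hV n, Set.finite_singleton _⟩, ?_⟩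
  rwa [Set.iUnion_singleton_eq_range]

theorem SelOne.mono {X : Type*} {A A' B B' : Set (Set (Set X))} (hA : A' ⊆ A) (hB : B ⊆ B')
    (h : SelOne A B) : SelOne A' B' := fun U hU =>
  let ⟨V, hV, hVB⟩ := h U fun n => hA (hU n)
  ⟨V, hV, hB hVB⟩

theorem SelFin.mono {X : Type*} {A A' B B' : Set (Set (Set X))} (hA : A' ⊆ A) (hB : B ⊆ B')
    (h : SelFin A B) : SelFin A' B' := fun U hU =>
  let ⟨V, hV, hVB⟩ := h U fun n => hA (hU n)
  ⟨V, hV, hB hVB⟩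

theorem openCovers_subset_denseFamilies (X : Type*) [TopologicalSpace X] :
    OpenCovers X ⊆ DenseFamilies X := by
  rintro U ⟨hU, -⟩
  change Dense (⋃₀ U)
  rw [hU]
  exact dense_univ

theorem denseOpenFamilies_subset_denseFamilies (X : Type*) [TopologicalSpace X] :
    DenseOpenFamilies X ⊆ DenseFamilies X := fun _ hU => hU.1

theorem selOne_openCovers_of_countable (X : Type*) [TopologicalSpace X] [Countable X] [Nonempty X] :
    SelOne (OpenCovers X) (OpenCovers X) := by
  intro U hU
  obtain ⟨e, he⟩ := exists_surjective_nat X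
  have h : ∀ n, ∃ V ∈ U n, e n ∈ V := fun n => by
    have : e n ∈ ⋃₀ U n := by rw [(hU n).1]; trivial
    exact this
  choose V hV heV using h
  refine ⟨V, hV, ?_, ?_⟩
  · refine Set.eq_univ_of_forall fun x => ?_
    obtain ⟨n, rfl⟩ := he x
    exact ⟨V n, ⟨n, rfl⟩, heV n⟩
  · rintro _ ⟨n, rfl⟩
    exact (hU n).2 _ (hV n)

/-! ### Pixley–Roy spaces -/

theorem PixleyRoy.isOpen_basic {X : Type*} [TopologicalSpace X] (F : PixleyRoy X) {U : Set X}
    (hU : IsOpen U) : IsOpen (PixleyRoy.basic F U) :=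
  TopologicalSpace.isOpen_generateFrom_of_mem ⟨F, U, hU, rfl⟩

theorem PixleyRoy.exists_basic_subset {X : Type*} [TopologicalSpace X] {W : Set (PixleyRoy X)}
    (hW : IsOpen W) : ∀ H ∈ W, ∃ U : Set X, IsOpen U ∧ (H.1 : Set X) ⊆ U ∧
      PixleyRoy.basic H U ⊆ W := by
  induction hW with
  | basic s hs =>
    obtain ⟨F, U, hU, rfl⟩ := hs
    exact fun H hH => ⟨U, hU, hH.2, fun K hK => ⟨hH.1.trans hK.1, hK.2⟩⟩
  | univ => exact fun H _ => ⟨Set.univ, isOpen_univ, Set.subset_univ _, Set.subset_univ _⟩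
  | inter s t _ _ hs ht =>
    rintro H ⟨h1, h2⟩
    obtain ⟨U, hU, hHU, hUs⟩ := hs H h1
    obtain ⟨V, hV, hHV, hVt⟩ := ht H h2
    exact ⟨U ∩ V, hU.inter hV, Set.subset_inter hHU hHV, fun K hK =>
      ⟨hUs ⟨hK.1, fun p hp => (hK.2 hp).1⟩, hVt ⟨hK.1, fun p hp => (hK.2 hp).2⟩⟩⟩
  | sUnion S _ ih =>
    rintro H ⟨s, hs, hH⟩
    obtain ⟨U, hU, hHU, hUs⟩ := ih s hs H hH
    exact ⟨U, hU, hHU, hUs.trans (Set.subset_sUnion_of_mem hs)⟩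

/-! ### Cantor tree spaces -/

namespace CantorTree

instance countable (X : Set (ℕ → Bool)) : Countable (CantorTree X) := by
  refine Function.Surjective.countable (f := fun o : Option (List Bool) =>
    o.elim (infty : CantorTree X) node) fun p => ?_
  cases p with
  | node s => exact ⟨some s, rfl⟩
  | infty => exact ⟨none, rfl⟩

theorem isOpen_iff {X : Set (ℕ → Bool)} {U : Set (CantorTree X)} :
    IsOpen U ↔ (infty ∈ U → ∃ (k : ℕ) (F : Set (ℕ → Bool)),
      F.Finite ∧ F ⊆ X ∧ basicNhd X k F ⊆ U) := Iff.rfl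

theorem node_mem_basicNhd {X : Set (ℕ → Bool)} {k : ℕ} {F : Set (ℕ → Bool)} {s : List Bool} :
    node s ∈ basicNhd X k F ↔ k < s.length ∧ ∀ f ∈ F, ¬ ExtendsSeq s f := by
  simp [basicNhd]

/-- A basic neighbourhood of the finite set `H` in `CT(X)`. -/
def setNhd {X : Set (ℕ → Bool)} (H : PixleyRoy (CantorTree X)) (k : ℕ) (G : Set X) :
    Set (CantorTree X) :=
  {p | p ∈ H.1 ∨ infty ∈ H.1 ∧ p ∈ basicNhd X k (Subtype.val '' G)}

theorem subset_setNhd {X : Set (ℕ → Bool)} (H : PixleyRoy (CantorTree X)) (k : ℕ) (G : Set X) :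
    (H.1 : Set (CantorTree X)) ⊆ setNhd H k G := fun _ hp => Or.inl hp

theorem isOpen_setNhd {X : Set (ℕ → Bool)} (H : PixleyRoy (CantorTree X)) (k : ℕ) {G : Set X}
    (hG : G.Finite) : IsOpen (setNhd H k G) := by
  refine isOpen_iff.2 fun h => ⟨k, Subtype.val '' G, hG.image _, by simp, fun p hp => ?_⟩
  have hH : infty ∈ H.1 := h.elim id And.left
  exact Or.inr ⟨hH, hp⟩

theorem exists_setNhd_subset {X : Set (ℕ → Bool)} {H : PixleyRoy (CantorTree X)}
    {U : Set (CantorTree X)} (hU : IsOpen U) (hH : (H.1 : Set (CantorTree X)) ⊆ U) :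
    ∃ (k : ℕ) (G : Set X), G.Finite ∧ setNhd H k G ⊆ U := by
  by_cases h : infty ∈ H.1
  · obtain ⟨k, F, hF, hFX, hFU⟩ := isOpen_iff.1 hU (hH h)
    refine ⟨k, Subtype.val ⁻¹' F, hF.preimage Subtype.val_injective.injOn, ?_⟩
    rintro p (hp | ⟨-, hp⟩)
    · exact hH hp
    · rw [Subtype.image_preimage_coe, Set.inter_eq_right.2 hFX] at hp
      exact hFU hp
  · refine ⟨0, ∅, Set.finite_empty, ?_⟩
    rintro p (hp | ⟨h', -⟩)
    · exact hH hp
    · exact absurd h' h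

theorem dense_pixleyRoy_iff {X : Set (ℕ → Bool)} {D : Set (PixleyRoy (CantorTree X))} :
    Dense D ↔ ∀ (H : PixleyRoy (CantorTree X)) (k : ℕ) (G : Set X), G.Finite →
      ∃ K ∈ D, K ∈ PixleyRoy.basic H (setNhd H k G) := by
  rw [dense_iff_inter_open]
  constructor
  · intro h H k G hG
    obtain ⟨K, hK, hKD⟩ := h _ (PixleyRoy.isOpen_basic H (isOpen_setNhd H k hG))
      ⟨H, subset_rfl, subset_setNhd H k G⟩
    exact ⟨K, hKD, hK⟩
  · rintro h W hW ⟨H, hH⟩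
    obtain ⟨U, hU, hHU, hUW⟩ := PixleyRoy.exists_basic_subset hW H hH
    obtain ⟨k, G, hG, hGU⟩ := exists_setNhd_subset hU hHU
    obtain ⟨K, hKD, hK⟩ := h H k G hG
    exact ⟨K, hUW ⟨hK.1, hK.2.trans hGU⟩, hKD⟩

theorem isClosed_setOf_extendsSeq (s : List Bool) : IsClosed {f | ExtendsSeq s f} := by
  have : {f | ExtendsSeq s f} = ⋂ i : Fin s.length, {f : ℕ → Bool | s[i] = f i} := by
    ext f
    simp only [Set.mem_ofPred_eq, Set.mem_iInter]
    exact ⟨fun h i => h i i.2, fun h i hi => h ⟨i, hi⟩⟩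
  rw [this]
  exact isClosed_iInter fun i => isClosed_eq continuous_const (continuous_apply (i : ℕ))

end CantorTree

/-! ### From `S_fin(Ω, Ω)` of `X` to `S_fin(D, D)` of the Pixley–Roy space -/

namespace CantorTree

/-- The set of points of `X` that extend no finite sequence in `K \ H`. -/
def avoidSet {X : Set (ℕ → Bool)} (H K : PixleyRoy (CantorTree X)) : Set X :=
  {x | ∀ p ∈ K.1, p ∉ H.1 → ∀ s, p = node s → ¬ ExtendsSeq s x.1}

/-- `K` is finite, and each of its nodes outside `H` excludes only a closed cylinder. -/
theorem isOpen_avoidSet {X : Set (ℕ → Bool)} (H K : PixleyRoy (CantorTree X)) :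
    IsOpen (avoidSet H K) := by
  have : avoidSet H K = ⋂ p ∈ K.1, {x : X | p ∉ H.1 → ∀ s, p = node s → ¬ ExtendsSeq s x.1} := by
    ext x
    simp [avoidSet]
  rw [this]
  refine isOpen_biInter_finset fun p _ => ?_
  by_cases hp : p ∈ H.1
  · simp [hp]
  cases p with
  | infty => simp
  | node s =>
    simp only [hp, not_false_eq_true, forall_const, node.injEq, forall_eq']
    exact (isClosed_setOf_extendsSeq s).isOpen_compl.preimage continuous_subtype_val

/-- This separates the role of `G` from that of `H` and `k`, so that finite sets `G` can be handled
by an ω-cover. -/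
theorem mem_basic_setNhd_iff {X : Set (ℕ → Bool)} {H K : PixleyRoy (CantorTree X)} {k : ℕ}
    {G : Set X} : K ∈ PixleyRoy.basic H (setNhd H k G) ↔
      K ∈ PixleyRoy.basic H (setNhd H k ∅) ∧ G ⊆ avoidSet H K := by
  constructor
  · rintro ⟨h1, h2⟩
    refine ⟨⟨h1, fun p hp => ?_⟩, fun x hx p hp hpH s hs => ?_⟩
    · rcases h2 hp with h | ⟨h, h'⟩
      · exact Or.inl h
      · refine Or.inr ⟨h, fun s hs => ?_⟩
        have := h' s hs
        simp only [Set.image_empty, Set.mem_empty_iff_false, false_and, exists_false, or_false]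
        exact fun hk => this (Or.inl hk)
    · obtain ⟨-, h⟩ := (h2 hp).resolve_left hpH
      exact fun hsx => h s hs (Or.inr ⟨x, ⟨x, hx, rfl⟩, hsx⟩)
  · rintro ⟨⟨h1, h2⟩, h3⟩
    refine ⟨h1, fun p hp => ?_⟩
    by_cases hpH : p ∈ H.1
    · exact Or.inl hpH
    obtain ⟨h, h'⟩ := (h2 hp).resolve_left hpH
    refine Or.inr ⟨h, ?_⟩
    rintro s hs (hk | ⟨_, ⟨x, hx, rfl⟩, hsx⟩)
    · exact h' s hs (Or.inl hk)
    · exact h3 hx p hp hpH s hs hsx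

theorem exists_finite_meeting_basic {X : Set (ℕ → Bool)}
    (hX : SelFin (OmegaCovers X) (OmegaCovers X)) (H : PixleyRoy (CantorTree X)) (k : ℕ)
    (U : ℕ → Set (Set (PixleyRoy (CantorTree X)))) (hU : ∀ n, U n ∈ DenseFamilies _) :
    ∃ F : ℕ → Set (Set (PixleyRoy (CantorTree X))), (∀ n, F n ⊆ U n ∧ (F n).Finite) ∧
      ∀ G : Set X, G.Finite → ∃ n, ∃ V ∈ F n, ∃ K ∈ V, K ∈ PixleyRoy.basic H (setNhd H k G) := by
  let C : ℕ → Set (Set X) := fun n =>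
    avoidSet H '' {K | K ∈ ⋃₀ U n ∧ K ∈ PixleyRoy.basic H (setNhd H k ∅)}
  have hC : ∀ n (G : Set X), G.Finite → ∃ V ∈ C n, G ⊆ V := fun n G hG => by
    obtain ⟨K, hK, hKb⟩ := dense_pixleyRoy_iff.1 (hU n) H k G hG
    obtain ⟨h1, h2⟩ := mem_basic_setNhd_iff.1 hKb
    exact ⟨_, ⟨K, ⟨hK, h1⟩, rfl⟩, h2⟩
  have hback : ∀ n, ∀ O ∈ C n, ∃ V ∈ U n, ∃ K ∈ V,
      K ∈ PixleyRoy.basic H (setNhd H k ∅) ∧ avoidSet H K = O := by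
    rintro n _ ⟨K, ⟨⟨V, hV, hKV⟩, hKb⟩, rfl⟩
    exact ⟨V, hV, K, hKV, hKb, rfl⟩
  choose! v hvU hv using hback
  -- `Ω` excludes covers containing the whole space, but `avoidSet H K` can be everything, for
  -- instance when `K = H`. Then a single member of one family meets all the neighbourhoods.
  by_cases huniv : ∃ n, Set.univ ∈ C n
  · obtain ⟨n, hn⟩ := huniv
    refine ⟨fun m => {V | m = n ∧ V = v n Set.univ}, fun m => ⟨?_, ?_⟩, fun G _ => ?_⟩
    · rintro _ ⟨rfl, rfl⟩
      exact hvU _ _ hn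
    · exact (Set.finite_singleton (v n Set.univ)).subset fun V hV => hV.2
    · obtain ⟨K, hK, hKb, hKO⟩ := hv n _ hn
      exact ⟨n, _, ⟨rfl, rfl⟩, K, hK, mem_basic_setNhd_iff.2 ⟨hKb, hKO ▸ Set.subset_univ _⟩⟩
  · push Not at huniv
    obtain ⟨F, hF, hFO⟩ := hX C fun n => by
      refine ⟨⟨Set.eq_univ_of_forall fun x => ?_, ?_⟩, hC n, huniv n⟩
      · obtain ⟨V, hV, hx⟩ := hC n {x} (Set.finite_singleton x)
        exact ⟨V, hV, hx rfl⟩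
      · rintro _ ⟨K, -, rfl⟩
        exact isOpen_avoidSet H K
    refine ⟨fun n => v n '' F n, fun n => ⟨?_, (hF n).2.image _⟩, fun G hG => ?_⟩
    · rintro _ ⟨O, hO, rfl⟩
      exact hvU n O ((hF n).1 hO)
    · obtain ⟨O, hO, hGO⟩ := hFO.2.1 G hG
      obtain ⟨n, hOn⟩ := Set.mem_iUnion.1 hO
      obtain ⟨K, hK, hKb, rfl⟩ := hv n O ((hF n).1 hOn)
      exact ⟨n, _, ⟨_, hOn, rfl⟩, K, hK, mem_basic_setNhd_iff.2 ⟨hKb, hGO⟩⟩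

end CantorTree

instance PixleyRoy.countable (X : Type*) [Countable X] : Countable (PixleyRoy X) :=
  inferInstanceAs (Countable {F : Finset X // F.Nonempty})

instance PixleyRoy.nonempty (X : Type*) [Nonempty X] : Nonempty (PixleyRoy X) :=
  ⟨⟨{Classical.arbitrary X}, Finset.singleton_nonempty _⟩⟩

instance CantorTree.nonempty (X : Set (ℕ → Bool)) : Nonempty (CantorTree X) := ⟨.infty⟩

theorem selFin_denseFamilies_of_selFin_omegaCovers {X : Set (ℕ → Bool)}
    (hX : SelFin (OmegaCovers X) (OmegaCovers X)) :
    SelFin (DenseFamilies (PixleyRoy (CantorTree X)))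
      (DenseFamilies (PixleyRoy (CantorTree X))) := by
  intro U hU
  obtain ⟨e, he⟩ := exists_surjective_nat (PixleyRoy (CantorTree X) × ℕ)
  -- The sequence of families is split into infinitely many subsequences, one for each pair `(H,
  -- k)`.
  have h := fun m => CantorTree.exists_finite_meeting_basic hX (e m).1 (e m).2
    (fun n => U (Nat.pair m n)) fun n => hU _
  choose F hF hFm using h
  refine ⟨fun j => F j.unpair.1 j.unpair.2, fun j => ?_, ?_⟩
  · simpa using hF j.unpair.1 j.unpair.2
  · refine CantorTree.dense_pixleyRoy_iff.2 fun H k G hG => ?_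
    obtain ⟨m, hm⟩ := he (H, k)
    obtain ⟨n, V, hV, K, hKV, hK⟩ := hFm m G hG
    rw [hm] at hK
    exact ⟨K, ⟨V, Set.mem_iUnion.2 ⟨Nat.pair m n, by simpa using hV⟩, hKV⟩, hK⟩

/-! ### From the Pixley–Roy space back to `X` -/

namespace CantorTree

/-- The open set of the Pixley–Roy space that corresponds to the set `V ⊆ X`: the sets `H` that
omit `∞`, or contain an initial segment of each point outside `V`. -/
def traceSet {X : Set (ℕ → Bool)} (V : Set X) : Set (PixleyRoy (CantorTree X)) :=
  {H | infty ∈ H.1 → ∀ x ∉ V, ∃ s, node s ∈ H.1 ∧ ExtendsSeq s x.1}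

/-- If `∞ ∈ H`, the condition persists when `H` is enlarged. If `∞ ∉ H`, then `H` is open in the
tree and `[H, H]` is a neighbourhood. -/
theorem isOpen_traceSet {X : Set (ℕ → Bool)} (V : Set X) : IsOpen (traceSet V) := by
  refine isOpen_iff_forall_mem_open.2 fun H hH => ?_
  by_cases h : infty ∈ H.1
  · refine ⟨PixleyRoy.basic H Set.univ, fun K hK _ x hx => ?_,
      PixleyRoy.isOpen_basic H isOpen_univ, subset_rfl, Set.subset_univ _⟩
    obtain ⟨s, hs, hsx⟩ := hH h x hx
    exact ⟨s, hK.1 hs, hsx⟩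
  · exact ⟨PixleyRoy.basic H H.1, fun K hK hK' => absurd (hK.2 hK') h,
      PixleyRoy.isOpen_basic H (isOpen_iff.2 fun h' => absurd h' h), subset_rfl, subset_rfl⟩

theorem exists_cylinder_subset {X : Set (ℕ → Bool)} {V : Set X} (hV : IsOpen V) {x : X}
    (hx : x ∈ V) : ∃ m, ∀ y : X, (∀ i < m, y.1 i = x.1 i) → y ∈ V := by
  obtain ⟨W, hW, rfl⟩ := isOpen_induced_iff.1 hV
  obtain ⟨_, ⟨z, m, rfl⟩, hz, hzW⟩ :=
    (PiNat.isTopologicalBasis_cylinders fun _ : ℕ => Bool).exists_subset_of_mem_open hx hW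
  refine ⟨m, fun y hy => hzW ?_⟩
  rw [PiNat.mem_cylinder_iff] at hz ⊢
  exact fun i hi => (hy i hi).trans (hz i hi)

theorem exists_finset_extendsSeq {X : Set (ℕ → Bool)} {V : Set X} (hV : IsOpen V) {G : Set X}
    (hG : G.Finite) (hGV : G ⊆ V) (k : ℕ) : ∃ A : Finset (List Bool),
      (∀ s ∈ A, k < s.length ∧ ∀ g ∈ G, ¬ ExtendsSeq s g.1) ∧
      ∀ x ∉ V, ∃ s ∈ A, ExtendsSeq s x.1 := by
  have h : ∀ g ∈ G, ∃ m, ∀ y : X, (∀ i < m, y.1 i = g.1 i) → y ∈ V := fun g hg =>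
    exists_cylinder_subset hV (hGV hg)
  choose! m hm using h
  obtain ⟨M, hM⟩ := (hG.image m).bddAbove
  -- At level `N` the cylinders around the points of `G` lie in `V`. Hence the length-`N` sequences
  -- extended by no point of `G` include the initial segment of every point outside `V`.
  obtain ⟨N, hMN, hkN⟩ : ∃ N, M ≤ N ∧ k < N := ⟨M + k + 1, by omega, by omega⟩
  have hfin : {s : List Bool | s.length = N ∧ ∀ g ∈ G, ¬ ExtendsSeq s g.1}.Finite :=
    (List.finite_length_eq Bool N).subset fun s hs => hs.1
  refine ⟨hfin.toFinset, fun s hs => ?_, fun x hx => ?_⟩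
  · obtain ⟨h1, h2⟩ := hfin.mem_toFinset.1 hs
    exact ⟨by omega, h2⟩
  · refine ⟨List.ofFn fun i : Fin N => x.1 i, ?_, fun i hi => by simp⟩
    refine hfin.mem_toFinset.2 ⟨by simp, fun g hg hgx => hx (hm g hg x fun i hi => ?_)⟩
    have hi' : i < N := by
      have := hM ⟨g, hg, rfl⟩
      omega
    exact (List.getElem_ofFn (by simpa using hi')).symm.trans (hgx i (by simpa using hi'))

theorem dense_sUnion_traceSet {X : Set (ℕ → Bool)} {C : Set (Set X)} (hC : C ∈ OmegaCovers X) :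
    Dense (⋃₀ (traceSet '' C)) := by
  classical
  refine dense_pixleyRoy_iff.2 fun H k G hG => ?_
  obtain ⟨V, hV, hGV⟩ := hC.2.1 G hG
  by_cases h : infty ∈ H.1
  · obtain ⟨A, hA, hAV⟩ := exists_finset_extendsSeq (hC.1.2 V hV) hG hGV k
    refine ⟨⟨H.1 ∪ A.image node, H.2.mono Finset.subset_union_left⟩,
      ⟨_, ⟨V, hV, rfl⟩, fun _ x hx => ?_⟩, ?_, ?_⟩
    · obtain ⟨s, hs, hsx⟩ := hAV x hx
      exact ⟨s, Finset.mem_union_right _ (Finset.mem_image_of_mem _ hs), hsx⟩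
    · exact Finset.coe_subset.2 Finset.subset_union_left
    · intro p hp
      rcases Finset.mem_union.1 (Finset.mem_coe.1 hp) with hp | hp
      · exact Or.inl hp
      · obtain ⟨s, hs, rfl⟩ := Finset.mem_image.1 hp
        refine Or.inr ⟨h, node_mem_basicNhd.2 ⟨(hA s hs).1, ?_⟩⟩
        rintro _ ⟨g, hg, rfl⟩
        exact (hA s hs).2 g hg
  · exact ⟨H, ⟨_, ⟨V, hV, rfl⟩, fun h' => absurd h' h⟩, subset_rfl, subset_setNhd H k G⟩

theorem mem_omegaCovers_of_dense {X : Set (ℕ → Bool)} {C : Set (Set X)}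
    (hopen : ∀ V ∈ C, IsOpen V) (huniv : Set.univ ∉ C) (hC : Dense (⋃₀ (traceSet '' C))) :
    C ∈ OmegaCovers X := by
  have h : ∀ G : Set X, G.Finite → ∃ V ∈ C, G ⊆ V := fun G hG => by
    obtain ⟨K, ⟨_, ⟨V, hV, rfl⟩, hKV⟩, h1, h2⟩ := dense_pixleyRoy_iff.1 hC
      -- A point of `G` outside `V` would extend a node of `K`, which this neighbourhood of `{∞}`
      -- forbids.
      ⟨{infty}, Finset.singleton_nonempty _⟩ 0 G hG
    refine ⟨V, hV, fun x hx => ?_⟩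
    by_contra hxV
    obtain ⟨s, hs, hsx⟩ := hKV (h1 (by simp)) x hxV
    rcases h2 hs with h | ⟨-, h⟩
    · simp at h
    · exact (node_mem_basicNhd.1 h).2 _ ⟨x, hx, rfl⟩ hsx
  refine ⟨⟨Set.eq_univ_of_forall fun x => ?_, hopen⟩, h, huniv⟩
  obtain ⟨V, hV, hx⟩ := h {x} (Set.finite_singleton x)
  exact ⟨V, hV, hx rfl⟩

theorem image_traceSet_mem_denseOpenFamilies {X : Set (ℕ → Bool)} {C : Set (Set X)}
    (hC : C ∈ OmegaCovers X) : traceSet '' C ∈ DenseOpenFamilies (PixleyRoy (CantorTree X)) := by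
  refine ⟨dense_sUnion_traceSet hC, ?_⟩
  rintro _ ⟨V, -, rfl⟩
  exact isOpen_traceSet V

end CantorTree

theorem selOne_omegaCovers_of_selOne_denseOpenFamilies {X : Set (ℕ → Bool)}
    (h : SelOne (DenseOpenFamilies (PixleyRoy (CantorTree X)))
      (DenseFamilies (PixleyRoy (CantorTree X)))) :
    SelOne (OmegaCovers X) (OmegaCovers X) := by
  intro U hU
  obtain ⟨W, hW, hWD⟩ := h (fun n => CantorTree.traceSet '' U n) fun n =>
    CantorTree.image_traceSet_mem_denseOpenFamilies (hU n)
  choose V hV hVW using hW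
  refine ⟨V, hV, CantorTree.mem_omegaCovers_of_dense ?_ ?_ ?_⟩
  · rintro _ ⟨n, rfl⟩
    exact (hU n).1.2 _ (hV n)
  · rintro ⟨n, hn⟩
    exact (hU n).2.2 (hn ▸ hV n)
  · rw [← Set.range_comp]
    have : CantorTree.traceSet ∘ V = W := funext hVW
    rwa [this]

theorem selFin_omegaCovers_of_selFin_denseOpenFamilies {X : Set (ℕ → Bool)}
    (h : SelFin (DenseOpenFamilies (PixleyRoy (CantorTree X)))
      (DenseFamilies (PixleyRoy (CantorTree X)))) :
    SelFin (OmegaCovers X) (OmegaCovers X) := by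
  intro U hU
  obtain ⟨W, hW, hWD⟩ := h (fun n => CantorTree.traceSet '' U n) fun n =>
    CantorTree.image_traceSet_mem_denseOpenFamilies (hU n)
  have hF : ∀ n, ∃ F ⊆ U n, F.Finite ∧ CantorTree.traceSet '' F = W n := fun n => by
    obtain ⟨F, h1, h2, h3⟩ := Set.exists_subset_image_finite_and
      (p := fun s => s = W n).1 ⟨W n, (hW n).1, (hW n).2, rfl⟩
    exact ⟨F, h1, h2, h3⟩
  choose F hFU hFf hFW using hF
  refine ⟨F, fun n => ⟨hFU n, hFf n⟩, CantorTree.mem_omegaCovers_of_dense ?_ ?_ ?_⟩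
  · intro V hV
    obtain ⟨n, hn⟩ := Set.mem_iUnion.1 hV
    exact (hU n).1.2 _ (hFU n hn)
  · intro hV
    obtain ⟨n, hn⟩ := Set.mem_iUnion.1 hV
    exact (hU n).2.2 (hFU n hn)
  · rw [Set.image_iUnion]
    simp_rw [hFW]
    exact hWD

/-! ### Compact spaces, the Cantor space and the Baire space -/

/-- The powers `Vⁿ` of the members of an ω-cover form an open cover of the compact space `Xⁿ`. -/
theorem exists_finite_covering_tuples {X : Type*} [TopologicalSpace X] [CompactSpace X]
    {U : Set (Set X)} (hU : U ∈ OmegaCovers X) (n : ℕ) :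
    ∃ F ⊆ U, F.Finite ∧ ∀ x : Fin n → X, ∃ V ∈ F, ∀ i, x i ∈ V := by
  obtain ⟨T, hTU, hT, hTc⟩ := isCompact_univ.elim_finite_subcover_image (b := U)
    (c := fun V : Set X => {x : Fin n → X | ∀ i, x i ∈ V})
    (fun V hV => by
      have : {x : Fin n → X | ∀ i, x i ∈ V} = Set.pi Set.univ fun _ => V := by ext; simp
      rw [this]
      exact isOpen_set_pi Set.finite_univ fun _ _ => hU.1.2 V hV)
    (fun x _ => by
      obtain ⟨V, hV, hx⟩ := hU.2.1 (Set.range x) (Set.finite_range x)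
      exact Set.mem_biUnion hV fun i => hx ⟨i, rfl⟩)
  refine ⟨T, hTU, hT, fun x => ?_⟩
  obtain ⟨V, hV, hx⟩ := Set.mem_iUnion₂.1 (hTc (Set.mem_univ x))
  exact ⟨V, hV, hx⟩

theorem selFin_omegaCovers_of_compactSpace (X : Type*) [TopologicalSpace X] [CompactSpace X] :
    SelFin (OmegaCovers X) (OmegaCovers X) := by
  intro U hU
  choose F hFU hFf hF using fun n => exists_finite_covering_tuples (hU n) n
  have h : ∀ G : Set X, G.Finite → ∃ V ∈ ⋃ n, F n, G ⊆ V := fun G hG => by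
    obtain ⟨n, x, -, rfl⟩ := hG.fin_param
    obtain ⟨V, hV, hx⟩ := hF n x
    exact ⟨V, Set.mem_iUnion.2 ⟨n, hV⟩, Set.range_subset_iff.2 hx⟩
  refine ⟨F, fun n => ⟨hFU n, hFf n⟩, ⟨Set.eq_univ_of_forall fun x => ?_, fun V hV => ?_⟩, h, ?_⟩
  · obtain ⟨V, hV, hx⟩ := h {x} (Set.finite_singleton x)
    exact ⟨V, hV, hx rfl⟩
  · obtain ⟨n, hn⟩ := Set.mem_iUnion.1 hV
    exact (hU n).1.2 V (hFU n hn)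
  · intro hV
    obtain ⟨n, hn⟩ := Set.mem_iUnion.1 hV
    exact (hU n).2.2 (hFU n hn)

theorem not_selOne_omegaCovers_of_Icc_subset_range {X : Type*} [TopologicalSpace X] {g : X → ℝ}
    (hg : Continuous g) (hrange : Set.Icc 0 1 ⊆ Set.range g) :
    ¬ SelOne (OmegaCovers X) (OmegaCovers X) := by
  intro h
  obtain ⟨ε, hε, hsum⟩ := ENNReal.exists_pos_sum_of_countable' (one_ne_zero (α := ENNReal)) ℕ
  let C : ℕ → Set (Set X) := fun n =>
    -- The bound `ε n` makes the chosen sets too small to cover `[0, 1]`; the bound `1` keeps the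
    -- whole space out of the cover.
    {V | ∃ O : Set ℝ, IsOpen O ∧ MeasureTheory.volume O < min (ε n) 1 ∧ V = g ⁻¹' O}
  have hC : ∀ n (G : Set X), G.Finite → ∃ V ∈ C n, G ⊆ V := fun n G hG => by
    have h0 : MeasureTheory.volume (g '' G) < min (ε n) 1 := by
      rw [(hG.image g).measure_zero]
      exact lt_min (hε n) one_pos
    obtain ⟨O, hGO, hO, hvol⟩ := Set.exists_isOpen_lt_of_lt _ _ h0
    exact ⟨_, ⟨O, hO, hvol, rfl⟩, Set.image_subset_iff.1 hGO⟩
  obtain ⟨V, hV, hVO⟩ := h C fun n => by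
    refine ⟨⟨Set.eq_univ_of_forall fun x => ?_, ?_⟩, hC n, ?_⟩
    · obtain ⟨V, hV, hx⟩ := hC n {x} (Set.finite_singleton x)
      exact ⟨V, hV, hx rfl⟩
    · rintro _ ⟨O, hO, -, rfl⟩
      exact hO.preimage hg
    · rintro ⟨O, -, hvol, heq⟩
      have : Set.Icc (0 : ℝ) 1 ⊆ O := hrange.trans (Set.preimage_eq_univ_iff.1 heq.symm)
      have := MeasureTheory.measure_mono (μ := MeasureTheory.volume) this
      rw [Real.volume_Icc] at this
      simp only [sub_zero, ENNReal.ofReal_one] at this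
      exact (hvol.trans_le (min_le_right _ _)).not_ge this
  choose O hO hvol hVeq using hV
  have hcover : Set.Icc (0 : ℝ) 1 ⊆ ⋃ n, O n := fun t ht => by
    obtain ⟨x, rfl⟩ := hrange ht
    have hx : x ∈ ⋃₀ Set.range V := by rw [hVO.1.1]; trivial
    obtain ⟨_, ⟨n, rfl⟩, hx⟩ := hx
    rw [hVeq n] at hx
    exact Set.mem_iUnion.2 ⟨n, hx⟩
  have h1 : (1 : ENNReal) ≤ ∑' n, ε n := calc
    (1 : ENNReal) = MeasureTheory.volume (Set.Icc (0 : ℝ) 1) := by simp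
    _ ≤ MeasureTheory.volume (⋃ n, O n) := MeasureTheory.measure_mono hcover
    _ ≤ ∑' n, MeasureTheory.volume (O n) := MeasureTheory.measure_iUnion_le _
    _ ≤ ∑' n, ε n := ENNReal.tsum_le_tsum fun n => ((hvol n).trans_le (min_le_left _ _)).le
  exact h1.not_gt hsum

theorem not_selOne_omegaCovers_cantor :
    ¬ SelOne (OmegaCovers (Set.univ : Set (ℕ → Bool)))
      (OmegaCovers (Set.univ : Set (ℕ → Bool))) := by
  obtain ⟨f, hf, hsurj⟩ := exists_nat_bool_continuous_surjective_of_compact (Set.Icc (0 : ℝ) 1)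
  refine not_selOne_omegaCovers_of_Icc_subset_range
    (g := fun x : (Set.univ : Set (ℕ → Bool)) => (f x.1 : ℝ)) (by fun_prop) fun t ht => ?_
  obtain ⟨x, hx⟩ := hsurj ⟨t, ht⟩
  exact ⟨⟨x, trivial⟩, by simp [hx]⟩

theorem not_selFin_omegaCovers_of_homeomorph_baire {X : Type*} [TopologicalSpace X]
    (e : X ≃ₜ (ℕ → ℕ)) : ¬ SelFin (OmegaCovers X) (OmegaCovers X) := by
  intro h
  -- Finitely many members of the `n`th cover bound the `n`th coordinate by some `b n`, so the point
  -- `b + 1` escapes every selection.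
  let C : ℕ → Set (Set X) := fun n => Set.range fun m => {x | e x n ≤ m}
  have hC : ∀ n (G : Set X), G.Finite → ∃ V ∈ C n, G ⊆ V := fun n G hG => by
    obtain ⟨m, hm⟩ := (hG.image fun x => e x n).bddAbove
    exact ⟨_, ⟨m, rfl⟩, fun x hx => hm ⟨x, hx, rfl⟩⟩
  obtain ⟨F, hF, hFO⟩ := h C fun n => by
    refine ⟨⟨Set.eq_univ_of_forall fun x => ?_, ?_⟩, hC n, ?_⟩
    · exact ⟨_, ⟨e x n, rfl⟩, le_refl (e x n)⟩
    · rintro _ ⟨m, rfl⟩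
      exact (isOpen_discrete (Set.Iic m)).preimage ((continuous_apply n).comp e.continuous)
    · rintro ⟨m, hm⟩
      have : e.symm (fun _ => m + 1) ∈ {x | e x n ≤ m} := by
        rw [show {x | e x n ≤ m} = Set.univ from hm]; trivial
      simp at this
  have hb : ∀ n, ∃ b : ℕ, ∀ V ∈ F n, ∀ x ∈ V, e x n ≤ b := fun n => by
    choose! m hm using fun V (hV : V ∈ F n) => (hF n).1 hV
    obtain ⟨b, hb⟩ := ((hF n).2.image m).bddAbove
    refine ⟨b, fun V hV x hx => ?_⟩
    rw [← hm V hV] at hx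
    exact le_trans hx (hb ⟨V, hV, rfl⟩)
  choose b hb using hb
  have hx : e.symm (fun n => b n + 1) ∈ ⋃₀ ⋃ n, F n := by rw [hFO.1.1]; trivial
  obtain ⟨V, hV, hx⟩ := hx
  obtain ⟨n, hn⟩ := Set.mem_iUnion.1 hV
  have := hb n V hn _ hx
  simp at this

/-- The characteristic function of the graph of `f`, along the pairing function. -/
def graphSeq (f : ℕ → ℕ) : ℕ → Bool := fun j => decide (f j.unpair.1 = j.unpair.2)

theorem graphSeq_pair (f : ℕ → ℕ) (n m : ℕ) : graphSeq f (Nat.pair n m) = decide (f n = m) := by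
  simp [graphSeq]

theorem isEmbedding_graphSeq : Topology.IsEmbedding graphSeq := by
  refine ⟨⟨le_antisymm ?_ ?_⟩, fun f g h => funext fun n => ?_⟩
  · rw [← continuous_iff_le_induced]
    refine continuous_pi fun j => ?_
    exact (continuous_of_discreteTopology (f := fun a : ℕ => decide (a = j.unpair.2))).comp
      (continuous_apply j.unpair.1)
  -- The inverse is continuous because `f n = m` is decided by the single bit at `Nat.pair n m`.
  · refine le_iInf fun n => ?_
    rw [← continuous_iff_le_induced]
    refine @continuous_discrete_rng _ _ (_) _ _ _ |>.2 fun m => ?_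
    refine isOpen_induced_iff.2 ⟨{x | x (Nat.pair n m) = true}, ?_, ?_⟩
    · exact (isOpen_discrete ({true} : Set Bool)).preimage
        (continuous_apply (A := fun _ : ℕ => Bool) (Nat.pair n m))
    · ext f
      simp [graphSeq_pair]
  · have := congrFun h (Nat.pair n (f n))
    simpa [graphSeq_pair, eq_comm] using this

theorem settingTwo_pixleyRoy_cantorTree {X : Set (ℕ → Bool)}
    (h : SelFin (OmegaCovers X) (OmegaCovers X)) (h' : ¬ SelOne (OmegaCovers X) (OmegaCovers X)) :
    SettingTwo (PixleyRoy (CantorTree X)) := by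
  have hD := selFin_denseFamilies_of_selFin_omegaCovers h
  have hO := selOne_openCovers_of_countable (PixleyRoy (CantorTree X))
  have hOD := hO.mono subset_rfl (openCovers_subset_denseFamilies _)
  have hn := mt selOne_omegaCovers_of_selOne_denseOpenFamilies h'
  exact ⟨⟨hD, hD.mono (denseOpenFamilies_subset_denseFamilies _) subset_rfl, hOD.selFin, hO.selFin⟩,
    fun hS => hn (hS.mono (denseOpenFamilies_subset_denseFamilies _) subset_rfl), hn, hOD, hO⟩

theorem settingThree_pixleyRoy_cantorTree {X : Set (ℕ → Bool)}
    (h : ¬ SelFin (OmegaCovers X) (OmegaCovers X)) : SettingThree (PixleyRoy (CantorTree X)) := by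
  have hO := selOne_openCovers_of_countable (PixleyRoy (CantorTree X))
  have hOD := hO.mono subset_rfl (openCovers_subset_denseFamilies _)
  have hn := mt selFin_omegaCovers_of_selFin_denseOpenFamilies h
  have hn' := fun hS : SelFin _ _ =>
    hn (hS.mono (denseOpenFamilies_subset_denseFamilies _) subset_rfl)
  exact ⟨⟨hn', hn, hOD.selFin, hO.selFin⟩,
    fun hS => hn' hS.selFin, fun hS => hn hS.selFin, hOD, hO⟩

theorem mainTheorem6 :
    (∀ X : Set (ℕ → Bool),
      Countable (PixleyRoy (CantorTree X)) ∧
      (SelFin (OmegaCovers X) (OmegaCovers X) → ¬ SelOne (OmegaCovers X) (OmegaCovers X) →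
        SettingTwo (PixleyRoy (CantorTree X))) ∧
      (¬ SelFin (OmegaCovers X) (OmegaCovers X) →
        SettingThree (PixleyRoy (CantorTree X)))) ∧
    (SelFin (OmegaCovers (Set.univ : Set (ℕ → Bool))) (OmegaCovers (Set.univ : Set (ℕ → Bool))) ∧
      ¬ SelOne (OmegaCovers (Set.univ : Set (ℕ → Bool)))
        (OmegaCovers (Set.univ : Set (ℕ → Bool)))) ∧
    (∃ X : Set (ℕ → Bool), Nonempty (X ≃ₜ (ℕ → ℕ))) ∧
    (∀ X : Set (ℕ → Bool), Nonempty (X ≃ₜ (ℕ → ℕ)) →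
      ¬ SelFin (OmegaCovers X) (OmegaCovers X)) :=
  ⟨fun _ => ⟨inferInstance, settingTwo_pixleyRoy_cantorTree, settingThree_pixleyRoy_cantorTree⟩,
    ⟨haveI := isCompact_iff_compactSpace.1 (isCompact_univ (X := ℕ → Bool))
     selFin_omegaCovers_of_compactSpace _, not_selOne_omegaCovers_cantor⟩,
    ⟨Set.range graphSeq, ⟨isEmbedding_graphSeq.toHomeomorph.symm⟩⟩,
    fun _ ⟨e⟩ => not_selFin_omegaCovers_of_homeomorph_baire e⟩
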